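/- **Definitions.** A linear code of length $n$ over $\mathbb Z_q=\mathbb Z/q\mathbb Z$ is a submodule $C\subseteq\mathbb Z_q^n$. Its dual is $C^\perp=\{v\in\mathbb Z_q^n : \sum_j v_jw_j=0 \text{ for all } w\in C\}$, and $C$ is self-dual if $C=C^\perp$. It is MDS if its minimum Hamming distance satisfies $d_H(C)=n-\log_q|C|+1$. Let $p$ be a prime and $N\ge 1$ an odd integer prime to $p$. A splitting of $N$ is a pair of disjoint sets $S_1,S_2$ with $S_1\cup S_2=\mathbb Z_N\setminus\{0\}$, each stable under multiplication by $p$, such that $bS_1=S_2$ and $bS_2=S_1$ for some $b\in\mathbb Z_N^{*}$. For a primitive $N$-th root of unity $\beta\in\overline{\mathbb F_p}$, the odd-like duadic code given by $\beta$ and $S_1$ is $$D=\Big\{c\in\mathbb Z_p^N : \sum_{j=0}^{N-1}c_j\beta^{tj}=0\text{ for all }t\in S_1\Big\}.$$ If $\gamma\in\mathbb Z_p$ satisfies $1+\gamma^2N=0$, the corresponding extended duadic code, of length $N+1$, is $\widetilde D=\{(c_0,\dots,c_{N-1},-\gamma\sum_j c_j) : c\in D\}$. A code $C'$ over $\mathbb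 Z_{p^e}$ is a lift of a code $C$ over $\mathbb Z_p$ if $C'$ is generated by the rows of a matrix whose reduction modulo $p$ has rows forming a basis of $C$. For pairwise coprime $q_1,\dots,q_s$ and codes $C_i$ of length $n$ over $\mathbb Z_{q_i}$, the Chinese product of the $C_i$ is the code $\{v\in\mathbb Z_{q_1\cdots q_s}^n : v \bmod q_i\in C_i \text{ for all } i\}$. **Theorem.** Let $n$ be a positive even integer and $m=\prod_{i=1}^s p_i^{e_i}$, where $s\ge1$, the $p_i$ are distinct primes, $e_i\ge1$, and $n-1$ divides $p_i-1$ for all $1\le i\le s$. Suppose that 1. $n\equiv 0\pmod 4$ and $p_i\equiv 3\pmod 4$ for all $1\le i\le s$, or 2. $n\equiv 2\pmod 4$ and $p_i\equiv 1\pmod 4$ for all $1\le i\le s$. Then there exist, for every $i$, an extended duadic code $E_i$ of length $n$ over $\mathbb Z_{p_i}$ that is MDS and self-dual, and a lift $C_i$ of $E_i$ over $\mathbb Z_{p_i^{e_i}}$ that is MDS and self-dual, such that the Chinese product of $C_1,\dots,C_s$ is an MDS self-dual code of length $n$ over $\mathbb Z_m$. -/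

import Mathlib

namespace RingCodes

/-- The dual of a linear code for the standard inner product `v · w = ∑ vᵢ wᵢ`. -/
def dualCode {R ι : Type*} [CommRing R] [Fintype ι] (C : Submodule R (ι → R)) :
    Submodule R (ι → R) where
  carrier := {v | ∀ w ∈ C, ∑ i, v i * w i = 0}
  zero_mem' := by
    intro w _
    simp
  add_mem' := by
    intro a b ha hb w hw
    simp [add_mul, Finset.sum_add_distrib, ha w hw, hb w hw]
  smul_mem' := by
    intro r a ha w hw
    simp [mul_assoc, ← Finset.mul_sum, ha w hw]

/-- A linear code is self-dual if it equals its dual. -/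
def IsSelfDual {R ι : Type*} [CommRing R] [Fintype ι] (C : Submodule R (ι → R)) : Prop :=
  C = dualCode C

/-- The minimum Hamming distance between distinct codewords (`0` if there are none). -/
noncomputable def minDist {R ι : Type*} [CommRing R] [DecidableEq R] [Fintype ι]
    (C : Submodule R (ι → R)) : ℕ :=
  sInf {d | ∃ x ∈ C, ∃ y ∈ C, x ≠ y ∧ hammingDist x y = d}

/-- A code meeting the Singleton bound `d ≤ n - log_{|R|} |C| + 1`. The zero code, for which
`minDist` is `0`, does not satisfy this equation. -/
def IsMDS {R ι : Type*} [CommRing R] [DecidableEq R] [Fintype ι]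
    (C : Submodule R (ι → R)) : Prop :=
  (minDist C : ℝ) = (Fintype.card ι : ℝ) - Real.logb (Nat.card R) (Nat.card C) + 1

/-- A splitting of `N` over the field with `p` elements: two disjoint sets, unions of
`p`-cyclotomic cosets, that cover the nonzero residues and are swapped by a multiplier. -/
def IsSplitting (p N : ℕ) (S₁ S₂ : Set (ZMod N)) : Prop :=
  S₁ ∪ S₂ = {0}ᶜ ∧ Disjoint S₁ S₂ ∧
  (∀ t ∈ S₁, (p : ZMod N) * t ∈ S₁) ∧ (∀ t ∈ S₂, (p : ZMod N) * t ∈ S₂) ∧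
  ∃ b : (ZMod N)ˣ, (fun t => (b : ZMod N) * t) '' S₁ = S₂ ∧
    (fun t => (b : ZMod N) * t) '' S₂ = S₁

/-- The words `c` of length `N` over the prime field such that the polynomial `∑ cⱼ xʲ` vanishes
at `βᵗ` for every `t ∈ T`; for a primitive `N`-th root of unity `β` this is the cyclic code
with defining set `T`. -/
noncomputable def codeWithZeros (p N : ℕ) [Fact p.Prime] (β : AlgebraicClosure (ZMod p))
    (T : Set (ZMod N)) : Submodule (ZMod p) (Fin N → ZMod p) where
  carrier := {c | ∀ t ∈ T, ∑ j : Fin N,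
    algebraMap (ZMod p) (AlgebraicClosure (ZMod p)) (c j) * β ^ (t.val * j.val) = 0}
  zero_mem' := by
    intro t _
    simp
  add_mem' := by
    intro a b ha hb t ht
    simp only [Pi.add_apply, map_add, add_mul, Finset.sum_add_distrib, ha t ht, hb t ht,
      add_zero]
  smul_mem' := by
    intro r a ha t ht
    simp only [Pi.smul_apply, smul_eq_mul, map_mul, mul_assoc, ← Finset.mul_sum, ha t ht,
      mul_zero]

/-- Odd-like duadic codes of odd length `N` over the field with `p` elements: cyclic codes
whose defining set is one half of a splitting of `N`. -/
def IsOddLikeDuadic (p N : ℕ) [Fact p.Prime] (D : Submodule (ZMod p) (Fin N → ZMod p)) :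
    Prop :=
  Odd N ∧ N.Coprime p ∧ ∃ β : AlgebraicClosure (ZMod p), IsPrimitiveRoot β N ∧
    ∃ S₁ S₂ : Set (ZMod N), IsSplitting p N S₁ S₂ ∧ D = codeWithZeros p N β S₁

/-- The words `(c₀, …, c_{N-1}, c_∞)` with `(c₀, …, c_{N-1}) ∈ D` and `c_∞ = -γ ∑ cⱼ`. -/
def extendedCode {F : Type*} [CommRing F] {N : ℕ} (γ : F) (D : Submodule F (Fin N → F)) :
    Submodule F (Fin (N + 1) → F) where
  carrier := {c | (fun j : Fin N => c j.castSucc) ∈ D ∧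
    c (Fin.last N) = -γ * ∑ j : Fin N, c j.castSucc}
  zero_mem' := by
    refine ⟨D.zero_mem, ?_⟩
    simp
  add_mem' := by
    rintro a b ⟨ha, ha'⟩ ⟨hb, hb'⟩
    refine ⟨D.add_mem ha hb, ?_⟩
    simp only [Pi.add_apply, Finset.sum_add_distrib, ha', hb', mul_add]
  smul_mem' := by
    rintro r a ⟨ha, ha'⟩
    refine ⟨D.smul_mem r ha, ?_⟩
    simp only [Pi.smul_apply, smul_eq_mul, ha', ← Finset.mul_sum]
    ring

/-- Extended odd-like duadic codes, of length `N + 1`: the extension parameter `γ` is a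
solution of `1 + γ² N = 0`. -/
def IsExtendedDuadic (p N : ℕ) [Fact p.Prime]
    (E : Submodule (ZMod p) (Fin (N + 1) → ZMod p)) : Prop :=
  ∃ (D : Submodule (ZMod p) (Fin N → ZMod p)) (γ : ZMod p),
    IsOddLikeDuadic p N D ∧ 1 + γ ^ 2 * (N : ZMod p) = 0 ∧ E = extendedCode γ D

/-- `C'` over `ℤ/p^e` is a lift of the code `C` over the prime field `ℤ/p`: it has a generator
matrix `G` whose reduction modulo `p` is a generator matrix of `C` (its rows form a basis
of `C`). -/
def IsLift {p e n : ℕ} (he : 0 < e) (C' : Submodule (ZMod (p ^ e)) (Fin n → ZMod (p ^ e)))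
    (C : Submodule (ZMod p) (Fin n → ZMod p)) : Prop :=
  ∃ (k : ℕ) (G : Matrix (Fin k) (Fin n) (ZMod (p ^ e))),
    Submodule.span (ZMod (p ^ e)) (Set.range G.row) = C' ∧
    LinearIndependent (ZMod p)
      (G.map (ZMod.castHom (dvd_pow_self p he.ne') (ZMod p))).row ∧
    Submodule.span (ZMod p)
      (Set.range (G.map (ZMod.castHom (dvd_pow_self p he.ne') (ZMod p))).row) = C

/-- The Chinese product of codes `Cᵢ` over `ℤ/qᵢ`: the words over `ℤ/∏ qᵢ` whose reduction
modulo `qᵢ` lies in `Cᵢ` for every `i`. -/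
def chineseProduct {s n : ℕ} (q : Fin s → ℕ)
    (C : ∀ i, Submodule (ZMod (q i)) (Fin n → ZMod (q i))) :
    Submodule (ZMod (∏ i, q i)) (Fin n → ZMod (∏ i, q i)) where
  carrier := {v | ∀ i, (fun j => ZMod.castHom
    (Finset.dvd_prod_of_mem q (Finset.mem_univ i)) (ZMod (q i)) (v j)) ∈ C i}
  zero_mem' := by
    intro i
    simp only [Pi.zero_apply, map_zero]
    exact (C i).zero_mem
  add_mem' := by
    intro a b ha hb i
    simp only [Pi.add_apply, map_add]
    exact (C i).add_mem (ha i) (hb i)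
  smul_mem' := by
    intro r a ha i
    simp only [Pi.smul_apply, smul_eq_mul, map_mul]
    exact (C i).smul_mem
      (ZMod.castHom (Finset.dvd_prod_of_mem q (Finset.mem_univ i)) (ZMod (q i)) r) (ha i)

end RingCodes

/-! All the codes are one construction over different rings. Over a commutative ring `R` with a pair
`(ζ, γ)`, the extended code consists of the evaluations of polynomials of degree `< k = (N + 1) / 2`
at `1, ζ, …, ζ ^ (N - 1), 0`, the last coordinate scaled by `-γ N` (`range_vecMulLinear_gen`).
Differences of these points are units, so every `k` columns form an invertible Vandermonde-type
matrix and the code is MDS; geometric sums and `1 + γ² N = 0` give self-duality. Pairs pass through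
ring homomorphisms and products, so reduction mod `p` yields `E_i`, and the Chinese remainder
isomorphism turns the Chinese product into the same code over `ℤ/m`. What remains is a pair over
`ℤ/p^e`: `N ∣ p - 1` supplies `ζ` mod `p`, quadratic reciprocity supplies `γ`, and a `p`-power trick
lifts both. -/

namespace RingCodes

/-! ### The evaluation code attached to a pair over a commutative ring. -/

section Splitting

variable {R S : Type*} [CommRing R] [CommRing S]

/-- `ζ` is an `N`-th root of unity whose nontrivial powers stay distinct modulo every maximal
ideal, and `γ` is a solution of `1 + γ² N = 0`. -/
structure IsCodePair (N : ℕ) (ζ γ : R) : Prop where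
  pow_eq_one : ζ ^ N = 1
  isUnit_pow_sub_one : ∀ m, 0 < m → m < N → IsUnit (ζ ^ m - 1)
  one_add_sq_mul : 1 + γ ^ 2 * (N : R) = 0

theorem IsCodePair.map {N : ℕ} {ζ γ : R} (h : IsCodePair N ζ γ) (f : R →+* S) :
    IsCodePair N (f ζ) (f γ) where
  pow_eq_one := by rw [← map_pow, h.pow_eq_one, map_one]
  isUnit_pow_sub_one m h0 hm := by
    simpa using (h.isUnit_pow_sub_one m h0 hm).map f
  one_add_sq_mul := by simpa using congrArg f h.one_add_sq_mul

theorem isCodePair_pi {ι : Type*} {A : ι → Type*} [∀ i, CommRing (A i)] {N : ℕ}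
    {ζ γ : ∀ i, A i} (h : ∀ i, IsCodePair N (ζ i) (γ i)) : IsCodePair N ζ γ where
  pow_eq_one := funext fun i => (h i).pow_eq_one
  isUnit_pow_sub_one m h0 hm := Pi.isUnit_iff.2 fun i => (h i).isUnit_pow_sub_one m h0 hm
  one_add_sq_mul := funext fun i => (h i).one_add_sq_mul

/-- The cyclic code whose zeros are `ζ ^ t` for `1 ≤ t < N / 2`. -/
def halfCyclicCode (N : ℕ) (ζ : R) : Submodule R (Fin N → R) where
  carrier := {c | ∀ t, 0 < t → 2 * t < N → ∑ j : Fin N, c j * ζ ^ (t * j.val) = 0}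
  zero_mem' := by
    intro t _ _
    simp
  add_mem' := by
    intro a b ha hb t h0 ht
    simp only [Pi.add_apply, add_mul, Finset.sum_add_distrib, ha t h0 ht, hb t h0 ht, add_zero]
  smul_mem' := by
    intro r a ha t h0 ht
    simp only [Pi.smul_apply, smul_eq_mul, mul_assoc, ← Finset.mul_sum, ha t h0 ht, mul_zero]

theorem mem_extendedCode_halfCyclicCode {N : ℕ} {ζ γ : R} {c : Fin (N + 1) → R} :
    c ∈ extendedCode γ (halfCyclicCode N ζ) ↔
      (∀ t, 0 < t → 2 * t < N → ∑ j : Fin N, c j.castSucc * ζ ^ (t * j.val) = 0) ∧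
      c (Fin.last N) = -γ * ∑ j : Fin N, c j.castSucc :=
  Iff.rfl

/-- The generator matrix of `extendedCode γ (halfCyclicCode N ζ)` evaluating polynomials at the
powers of `ζ` and at `0`. -/
def halfCyclicGen (N k : ℕ) (ζ γ : R) : Matrix (Fin k) (Fin (N + 1)) R :=
  Matrix.of fun i => Fin.snoc (α := fun _ => R) (fun j : Fin N => ζ ^ (i.val * j.val))
    (-γ * N * 0 ^ i.val)

@[simp]
theorem halfCyclicGen_castSucc (N k : ℕ) (ζ γ : R) (i : Fin k) (j : Fin N) :
    halfCyclicGen N k ζ γ i j.castSucc = ζ ^ (i.val * j.val) := by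
  simp [halfCyclicGen]

@[simp]
theorem halfCyclicGen_last (N k : ℕ) (ζ γ : R) (i : Fin k) :
    halfCyclicGen N k ζ γ i (Fin.last N) = -γ * N * 0 ^ i.val := by
  simp [halfCyclicGen]

theorem map_halfCyclicGen (N k : ℕ) (ζ γ : R) (f : R →+* S) :
    (halfCyclicGen N k ζ γ).map f = halfCyclicGen N k (f ζ) (f γ) := by
  ext i j
  induction j using Fin.lastCases <;> simp

namespace IsCodePair

variable {N k : ℕ} {ζ γ : R}

theorem isUnit_root (h : IsCodePair N ζ γ) (hN : N ≠ 0) : IsUnit ζ :=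
  IsUnit.of_pow_eq_one h.pow_eq_one hN

theorem mul_isUnit (h : IsCodePair N ζ γ) : IsUnit (-γ * (N : R)) :=
  IsUnit.of_mul_eq_one γ (by linear_combination -h.one_add_sq_mul)

/-- The geometric sum times `ζ ^ m - 1` is `0`; as `R` may have zero divisors, that factor must be a
unit to be cancelled. -/
theorem sum_pow (h : IsCodePair N ζ γ) (hN : N ≠ 0) (m : ℕ) :
    ∑ j : Fin N, ζ ^ (m * j.val) = if N ∣ m then (N : R) else 0 := by
  split_ifs with hm
  · obtain ⟨d, rfl⟩ := hm
    simp [pow_mul, h.pow_eq_one]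
  · have hu : IsUnit (ζ ^ m - 1) := by
      have : ζ ^ m = ζ ^ (m % N) := by
        conv_lhs => rw [← Nat.div_add_mod m N, pow_add, pow_mul, h.pow_eq_one, one_pow, one_mul]
      rw [this]
      exact h.isUnit_pow_sub_one _ (Nat.pos_of_ne_zero fun h0 => hm (Nat.dvd_of_mod_eq_zero h0))
        (Nat.mod_lt _ (Nat.pos_of_ne_zero hN))
    rw [← hu.mul_left_eq_zero]
    simp_rw [pow_mul]
    rw [Fin.sum_univ_eq_sum_range (fun j => (ζ ^ m) ^ j), geom_sum_mul, ← pow_mul, mul_comm m,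
      pow_mul, h.pow_eq_one, one_pow, sub_self]

theorem gen_row_mem (h : IsCodePair N ζ γ) (hk : N + 1 = 2 * k) (i : Fin k) :
    halfCyclicGen N k ζ γ i ∈ extendedCode γ (halfCyclicCode N ζ) := by
  rw [mem_extendedCode_halfCyclicCode]
  have hi := i.isLt
  constructor
  · intro t h0 ht
    simp_rw [halfCyclicGen_castSucc, ← pow_add, ← add_mul]
    rw [h.sum_pow (by omega), if_neg (Nat.not_dvd_of_pos_of_lt (by omega) (by omega))]
  · simp_rw [halfCyclicGen_castSucc, halfCyclicGen_last]
    rw [h.sum_pow (by omega)]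
    rcases Nat.eq_zero_or_pos i.val with h0 | h0
    · simp [h0]
    · rw [if_neg (Nat.not_dvd_of_pos_of_lt h0 (by omega))]
      simp [h0.ne']

theorem gen_mul_transpose (h : IsCodePair N ζ γ) (hk : N + 1 = 2 * k) :
    halfCyclicGen N k ζ γ * (halfCyclicGen N k ζ γ).transpose = 0 := by
  ext i l
  have hi := i.isLt
  have hl := l.isLt
  simp_rw [Matrix.mul_apply, Matrix.transpose_apply, Fin.sum_univ_castSucc,
    halfCyclicGen_castSucc, halfCyclicGen_last, ← pow_add, ← add_mul]
  rw [h.sum_pow (by omega)]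
  rcases Nat.eq_zero_or_pos (i.val + l.val) with h0 | h0
  · have h1 : i.val = 0 := by omega
    have h2 : l.val = 0 := by omega
    simp only [h1, h2, add_zero, dvd_zero, if_true, pow_zero, Matrix.zero_apply]
    linear_combination (N : R) * h.one_add_sq_mul
  · rw [if_neg (Nat.not_dvd_of_pos_of_lt h0 (by omega))]
    rcases Nat.eq_zero_or_pos i.val with h1 | h1
    · have h2 : l.val ≠ 0 := by omega
      simp [h2]
    · simp [h1.ne']

/-- Fourier inversion for the words of the code. -/
theorem exists_vecMul_gen (h : IsCodePair N ζ γ) (hk : N + 1 = 2 * k) {c : Fin (N + 1) → R}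
    (hc : c ∈ extendedCode γ (halfCyclicCode N ζ)) :
    ∃ a : Fin k → R, Matrix.vecMul a (halfCyclicGen N k ζ γ) = c := by
  have hN : N ≠ 0 := by omega
  rw [mem_extendedCode_halfCyclicCode] at hc
  obtain ⟨hc, hc'⟩ := hc
  obtain ⟨η, hη⟩ : ∃ η, ζ * η = 1 := (h.isUnit_root hN).exists_right_inv
  have hN1 : η ^ N = 1 := by
    have := congrArg (· ^ N) hη
    simpa [mul_pow, h.pow_eq_one] using this
  have hnu : (-γ ^ 2) * (N : R) = 1 := by linear_combination -h.one_add_sq_mul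
  -- Inverse Fourier coefficients: `η = ζ⁻¹` and `-γ²` is the inverse of `N`.
  let b : ℕ → R := fun i => (-γ ^ 2) * ∑ l : Fin N, c l.castSucc * η ^ (i * l.val)
  -- `η ^ i = ζ ^ (N - i)`, and `0 < 2 (N - i) < N` makes this one of the prescribed zeros.
  have hb : ∀ i, k ≤ i → i < N → b i = 0 := by
    intro i hi hiN
    have : ∀ l : Fin N, η ^ (i * l.val) = ζ ^ ((N - i) * l.val) := by
      intro l
      have h1 : ζ ^ ((N - i) * l.val) * ζ ^ (i * l.val) = 1 := by
        rw [← pow_add, ← add_mul, Nat.sub_add_cancel hiN.le, pow_mul, h.pow_eq_one, one_pow]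
      have h2 : ζ ^ (i * l.val) * η ^ (i * l.val) = 1 := by rw [← mul_pow, hη, one_pow]
      linear_combination -(η ^ (i * l.val)) * h1 + ζ ^ ((N - i) * l.val) * h2
    simp only [b, this]
    rw [hc (N - i) (by omega) (by omega), mul_zero]
  have hsum : ∀ j : Fin N, ∑ i : Fin k, b i * ζ ^ (i.val * j.val) = c j.castSucc := by
    intro j
    have h1 : ∑ i : Fin k, b i * ζ ^ (i.val * j.val) = ∑ i : Fin N, b i * ζ ^ (i.val * j.val) := by
      rw [Fin.sum_univ_eq_sum_range (fun i => b i * ζ ^ (i * j.val)),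
        Fin.sum_univ_eq_sum_range (fun i => b i * ζ ^ (i * j.val))]
      refine Finset.sum_subset (Finset.range_mono (by omega)) fun i hi hi' => ?_
      rw [hb i (by simpa using hi') (by simpa using hi), zero_mul]
    have h2 : ∀ l : Fin N, ∑ i : Fin N, η ^ (i.val * l.val) * ζ ^ (i.val * j.val) =
        if l = j then (N : R) else 0 := by
      intro l
      have h3 : ∀ i : Fin N, η ^ (i.val * l.val) * ζ ^ (i.val * j.val) =
          ζ ^ ((N - l.val + j.val) * i.val) := by
        intro i
        have h4 : ζ ^ ((N - l.val) * i.val) * ζ ^ (i.val * l.val) = 1 := by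
          rw [mul_comm i.val, ← pow_add, ← add_mul, Nat.sub_add_cancel l.isLt.le, pow_mul,
            h.pow_eq_one, one_pow]
        have h5 : ζ ^ (i.val * l.val) * η ^ (i.val * l.val) = 1 := by rw [← mul_pow, hη, one_pow]
        rw [add_mul, pow_add, mul_comm j.val]
        linear_combination ζ ^ (i.val * j.val) *
          (-(η ^ (i.val * l.val)) * h4 + ζ ^ ((N - l.val) * i.val) * h5)
      simp_rw [h3]
      rw [h.sum_pow (by omega)]
      have hl := l.isLt
      have hj := j.isLt
      -- The exponent `N - l + j` lies strictly between `0` and `2 N`, so `N` divides it only when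
      -- `l = j`.
      refine if_congr ?_ rfl rfl
      constructor
      · rintro ⟨d, hd⟩
        ext
        have hd1 : d = 1 := by
          have : 0 < d := Nat.pos_of_ne_zero (by rintro rfl; omega)
          have : d < 2 := by
            by_contra! hd2
            have := Nat.mul_le_mul_left N hd2
            omega
          omega
        subst hd1
        omega
      · rintro rfl
        rw [Nat.sub_add_cancel hl.le]
    rw [h1]
    simp_rw [b, Finset.mul_sum, Finset.sum_mul]
    rw [Finset.sum_comm]
    calc _ = ∑ l : Fin N, (-γ ^ 2) * c l.castSucc *
          ∑ i : Fin N, η ^ (i.val * l.val) * ζ ^ (i.val * j.val) := by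
          refine Finset.sum_congr rfl fun l _ => ?_
          rw [Finset.mul_sum]
          exact Finset.sum_congr rfl fun i _ => by ring
      _ = c j.castSucc := by
          simp only [h2, mul_ite, mul_zero, Finset.sum_ite_eq', Finset.mem_univ, if_true]
          linear_combination c j.castSucc * hnu
  refine ⟨fun i => b i, ?_⟩
  ext j
  rw [Matrix.vecMul, dotProduct]
  induction j using Fin.lastCases with
  | cast j => simpa using hsum j
  | last =>
    obtain ⟨k, rfl⟩ : ∃ k', k = k' + 1 := ⟨k - 1, by omega⟩
    rw [Fin.sum_univ_succ, hc']
    simp only [halfCyclicGen_last, Fin.val_succ, pow_succ, Fin.val_zero, pow_zero, mul_zero,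
      Finset.sum_const_zero, b, zero_mul, mul_one, add_zero]
    linear_combination (-γ * ∑ j : Fin N, c j.castSucc) * hnu

theorem range_vecMulLinear_gen (h : IsCodePair N ζ γ) (hk : N + 1 = 2 * k) :
    LinearMap.range (halfCyclicGen N k ζ γ).vecMulLinear =
      extendedCode γ (halfCyclicCode N ζ) := by
  apply le_antisymm
  · rw [range_vecMulLinear, Submodule.span_le]
    rintro _ ⟨i, rfl⟩
    exact h.gen_row_mem hk i
  · intro c hc
    exact h.exists_vecMul_gen hk hc

/-- No cardinality count is needed: orthogonality to row `t > 0` is the zero at `ζ ^ t`, and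
orthogonality to row `0`, multiplied by `γ`, is the extension condition. -/
theorem isSelfDual (h : IsCodePair N ζ γ) (hN : Odd N) :
    IsSelfDual (extendedCode γ (halfCyclicCode N ζ)) := by
  obtain ⟨k, hk⟩ : ∃ k, N + 1 = 2 * k := hN.add_one.two_dvd
  apply le_antisymm
  · intro v hv w hw
    obtain ⟨a, rfl⟩ := h.exists_vecMul_gen hk hv
    obtain ⟨b, rfl⟩ := h.exists_vecMul_gen hk hw
    change Matrix.vecMul a _ ⬝ᵥ Matrix.vecMul b _ = 0
    rw [← Matrix.mulVec_transpose _ b, Matrix.dotProduct_mulVec, Matrix.vecMul_vecMul,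
      h.gen_mul_transpose hk, Matrix.vecMul_zero, zero_dotProduct]
  · intro v hv
    rw [mem_extendedCode_halfCyclicCode]
    have hrow : ∀ i : Fin k, ∑ j, v j * halfCyclicGen N k ζ γ i j = 0 :=
      fun i => hv _ (h.gen_row_mem hk i)
    simp only [Fin.sum_univ_castSucc, halfCyclicGen_castSucc, halfCyclicGen_last] at hrow
    constructor
    · intro t h0 ht
      simpa [h0.ne'] using hrow ⟨t, by omega⟩
    · have := hrow ⟨0, by have := hN.pos; omega⟩
      simp only [zero_mul, pow_zero, mul_one] at this
      linear_combination γ * this + v (Fin.last N) * h.one_add_sq_mul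

/-- A polynomial of degree `< k` vanishing at `k` points with unit differences is zero, by
invertibility of the Vandermonde matrix. This replaces root counting, which fails over a general
ring. -/
theorem eq_zero_of_card_le (h : IsCodePair N ζ γ) {a : Fin k → R} {s : Finset (Fin (N + 1))}
    (hs : k ≤ s.card) (ha : ∀ j ∈ s, Matrix.vecMul a (halfCyclicGen N k ζ γ) j = 0) : a = 0 := by
  let x : Fin (N + 1) → R := Fin.snoc (α := fun _ => R) (fun j : Fin N => ζ ^ j.val) 0
  let u : Fin (N + 1) → R := Fin.snoc (α := fun _ => R) (fun _ => 1) (-γ * N)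
  have hG : ∀ i j, halfCyclicGen N k ζ γ i j = u j * x j ^ i.val := by
    intro i j
    induction j using Fin.lastCases with
    | cast j => simp [u, x, ← pow_mul, mul_comm]
    | last => simp [u, x]
  have hu : ∀ j, IsUnit (u j) := by
    intro j
    induction j using Fin.lastCases with
    | cast j => simp [u]
    | last => simpa [u] using h.mul_isUnit
  have hx : ∀ i j, i < j → IsUnit (x j - x i) := by
    intro i j hij
    induction i using Fin.lastCases with
    | last => exact absurd hij (Fin.le_last j).not_gt
    | cast i =>
      have hi := (h.isUnit_root (by have := i.isLt; omega)).pow i.val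
      induction j using Fin.lastCases with
      | last => simpa [x] using hi.neg
      | cast j =>
        have hij' : i.val < j.val := hij
        have : x j.castSucc - x i.castSucc = ζ ^ i.val * (ζ ^ (j.val - i.val) - 1) := by
          simp only [x, Fin.snoc_castSucc]
          rw [mul_sub, ← pow_add, Nat.add_sub_cancel' hij'.le, mul_one]
        rw [this]
        exact hi.mul (h.isUnit_pow_sub_one _ (by omega) (by omega))
  obtain ⟨t, hts, htk⟩ := Finset.exists_subset_card_eq hs
  let f := t.orderEmbOfFin htk
  have hV : IsUnit (Matrix.vandermonde fun i => x (f i)) := by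
    rw [Matrix.isUnit_iff_isUnit_det, Matrix.det_vandermonde]
    refine IsUnit.prod_univ_iff.2 fun i => IsUnit.prod_iff.2 fun j hj => hx _ _ ?_
    exact f.strictMono (Finset.mem_Ioi.1 hj)
  apply Matrix.mulVec_injective_of_isUnit hV
  ext i
  have := ha (f i) (hts (t.orderEmbOfFin_mem htk i))
  rw [Matrix.vecMul, dotProduct] at this
  simp_rw [hG] at this
  rw [Matrix.mulVec_zero, Pi.zero_apply, Matrix.mulVec, dotProduct, ← (hu (f i)).mul_right_eq_zero,
    Finset.mul_sum, ← this]
  refine Finset.sum_congr rfl fun l _ => ?_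
  rw [Matrix.vandermonde_apply]
  ring

theorem vecMul_gen_injective (h : IsCodePair N ζ γ) (hk : N + 1 = 2 * k) :
    Function.Injective (halfCyclicGen N k ζ γ).vecMulLinear := by
  rw [← LinearMap.ker_eq_bot, LinearMap.ker_eq_bot']
  intro a ha
  refine h.eq_zero_of_card_le (s := Finset.univ) ?_ fun j _ => congrFun ha j
  simp only [Finset.card_univ, Fintype.card_fin]
  omega

end IsCodePair

/-! ### The MDS property. -/

theorem isMDS_of_card_eq {ι : Type*} [Fintype ι] [DecidableEq R] [Finite R] [Nontrivial R]
    {C : Submodule R (ι → R)} {k : ℕ} (hk : 0 < k) (hkn : k ≤ Fintype.card ι)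
    (hcard : Nat.card C = Nat.card R ^ k)
    (hd : ∀ c ∈ C, c ≠ 0 → Fintype.card ι < hammingNorm c + k) : IsMDS C := by
  have := Fintype.ofFinite R
  have hR : 1 < Nat.card R := Finite.one_lt_card
  obtain ⟨T, -, hT⟩ := Finset.exists_subset_card_eq (s := (Finset.univ : Finset ι))
    (n := k - 1) (by rw [Finset.card_univ]; omega)
  have hmin : minDist C = Fintype.card ι - k + 1 := by
    have hlow : ∀ x ∈ C, ∀ y ∈ C, x ≠ y → Fintype.card ι - k + 1 ≤ hammingDist x y := by
      intro x hx y hy hxy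
      rw [hammingDist_eq_hammingNorm]
      have := hd _ (C.sub_mem hy hx) (sub_ne_zero.2 hxy.symm)
      rw [neg_add_eq_sub]
      omega
    -- Singleton bound by pigeonhole: two codewords agree on the `k - 1` positions of `T`.
    have hcl : Nat.card (T → R) < Nat.card C := by
      rw [hcard, Nat.card_fun, Nat.card_eq_fintype_card (α := T), Fintype.card_coe, hT]
      exact Nat.pow_lt_pow_right hR (by omega)
    obtain ⟨x, y, hxy, hxyT⟩ : ∃ x y : C, x ≠ y ∧
        (fun t : T => x.1 t.1) = (fun t : T => y.1 t.1) := by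
      by_contra! hcon
      refine hcl.not_ge (Nat.card_le_card_of_injective (fun (x : C) (t : T) => x.1 t.1) ?_)
      intro x y hxy
      by_contra hne
      exact hcon x y hne hxy
    have hne : x.1 ≠ y.1 := fun h => hxy (Subtype.ext h)
    have hup : hammingDist x.1 y.1 ≤ Fintype.card ι - k + 1 := by
      classical
      have hsub : (Finset.univ.filter fun i => x.1 i ≠ y.1 i) ⊆ Tᶜ := by
        intro i hi
        rw [Finset.mem_compl]
        intro hiT
        exact (Finset.mem_filter.1 hi).2 (congrFun hxyT ⟨i, hiT⟩)
      have := Finset.card_le_card hsub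
      rw [Finset.card_compl, hT] at this
      unfold hammingDist
      omega
    apply le_antisymm
    · have hle : minDist C ≤ hammingDist x.1 y.1 := Nat.sInf_le ⟨x.1, x.2, y.1, y.2, hne, rfl⟩
      exact hle.trans hup
    · refine le_csInf ⟨hammingDist x.1 y.1, x.1, x.2, y.1, y.2, hne, rfl⟩ ?_
      rintro _ ⟨x, hx, y, hy, hxy, rfl⟩
      exact hlow x hx y hy hxy
  have hR' : (1 : ℝ) < Nat.card R := by exact_mod_cast hR
  rw [IsMDS, hmin, hcard, Nat.cast_pow, Real.logb_pow, Real.logb_self_eq_one hR', mul_one]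
  push_cast [Nat.cast_sub hkn]
  ring

theorem IsCodePair.isMDS [DecidableEq R] [Finite R] [Nontrivial R] {N : ℕ} {ζ γ : R}
    (h : IsCodePair N ζ γ) (hN : Odd N) : IsMDS (extendedCode γ (halfCyclicCode N ζ)) := by
  obtain ⟨k, hk⟩ : ∃ k, N + 1 = 2 * k := hN.add_one.two_dvd
  refine isMDS_of_card_eq (k := k) (by omega) (by rw [Fintype.card_fin]; omega) ?_ ?_
  · rw [← h.range_vecMulLinear_gen hk,
      ← Nat.card_congr (LinearEquiv.ofInjective _ (h.vecMul_gen_injective hk)).toEquiv,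
      Nat.card_fun, Nat.card_fin]
  · intro c hc hc0
    obtain ⟨a, rfl⟩ := h.exists_vecMul_gen hk hc
    by_contra! hle
    apply hc0
    have hsplit := Finset.card_filter_add_card_filter_not (s := (Finset.univ : Finset (Fin (N + 1))))
      (fun j => Matrix.vecMul a (halfCyclicGen N k ζ γ) j = 0)
    rw [h.eq_zero_of_card_le (a := a) (s := Finset.univ.filter fun j =>
      Matrix.vecMul a (halfCyclicGen N k ζ γ) j = 0) ?_ (by simp), Matrix.zero_vecMul]
    unfold hammingNorm at hle
    rw [Finset.card_univ] at hsplit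
    simp only [ne_eq] at hle
    omega

end Splitting

/-! ### Lifts, Chinese products and duadic structure. -/

theorem isLift_extendedCode {p e N : ℕ} (he : 0 < e) {ζ γ : ZMod (p ^ e)}
    (h : IsCodePair N ζ γ) (hN : Odd N) (f : ZMod (p ^ e) →+* ZMod p) :
    IsLift he (extendedCode γ (halfCyclicCode N ζ))
      (extendedCode (f γ) (halfCyclicCode N (f ζ))) := by
  obtain ⟨k, hk⟩ : ∃ k, N + 1 = 2 * k := hN.add_one.two_dvd
  refine ⟨k, halfCyclicGen N k ζ γ, ?_, ?_, ?_⟩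
  · rw [← range_vecMulLinear, h.range_vecMulLinear_gen hk]
  · rw [Subsingleton.elim (ZMod.castHom _ _) f, map_halfCyclicGen, ← Matrix.vecMul_injective_iff]
    exact (h.map f).vecMul_gen_injective hk
  · rw [Subsingleton.elim (ZMod.castHom _ _) f, map_halfCyclicGen, ← range_vecMulLinear,
      (h.map f).range_vecMulLinear_gen hk]

theorem chineseProduct_extendedCode {s N : ℕ} (q : Fin s → ℕ)
    (hq : Pairwise (Function.onFun Nat.Coprime q)) (ζ γ : ZMod (∏ i, q i)) :
    chineseProduct q (fun i => extendedCode (ZMod.prodEquivPi q hq γ i)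
      (halfCyclicCode N (ZMod.prodEquivPi q hq ζ i))) = extendedCode γ (halfCyclicCode N ζ) := by
  have heq : ∀ a b : ZMod (∏ i, q i), a = b ↔ ∀ i, ZMod.castHom
      (Finset.dvd_prod_of_mem q (Finset.mem_univ i)) (ZMod (q i)) a = ZMod.castHom
      (Finset.dvd_prod_of_mem q (Finset.mem_univ i)) (ZMod (q i)) b := by
    intro a b
    rw [← (ZMod.prodEquivPi q hq).injective.eq_iff, funext_iff]
    simp only [ZMod.prodEquivPi_apply]
  ext v
  change (∀ i, _ ∈ extendedCode _ _) ↔ _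
  simp only [mem_extendedCode_halfCyclicCode, heq, ZMod.prodEquivPi_apply, forall_and, map_sum,
    map_mul, map_pow, map_neg, map_zero]
  refine and_congr ⟨fun h t h0 ht i => h i t h0 ht, fun h i t h0 ht => h t h0 ht i⟩ Iff.rfl

/-- Since `p = 1` in `ℤ/N`, stability under `p` is vacuous, and the multiplier `-1` swaps the
halves. -/
theorem isSplitting_half (p N : ℕ) (hN : Odd N) (hp : (p : ZMod N) = 1) :
    IsSplitting p N {t | 0 < t.val ∧ 2 * t.val < N} {t | N < 2 * t.val} := by
  have : NeZero N := ⟨hN.pos.ne'⟩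
  obtain ⟨k, hk⟩ := hN
  have hneg : ∀ t : ZMod N, 0 < t.val → (-t).val = N - t.val := by
    intro t ht
    have : NeZero t := ⟨fun h => by simp [h] at ht⟩
    exact ZMod.val_neg_of_ne_zero t
  have hlt := fun t : ZMod N => ZMod.val_lt t
  refine ⟨?_, ?_, ?_, ?_, -1, ?_, ?_⟩
  · ext t
    simp only [Set.mem_union, Set.mem_ofPred_eq, Set.mem_compl_iff, Set.mem_singleton_iff,
      ← ZMod.val_eq_zero t]
    omega
  · rw [Set.disjoint_left]
    intro t h1 h2
    simp only [Set.mem_ofPred_eq] at h1 h2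
    omega
  · intro t ht
    rwa [hp, one_mul]
  · intro t ht
    rwa [hp, one_mul]
  all_goals
    ext t
    have ht := hlt t
    simp only [Units.val_neg, Units.val_one, neg_mul, one_mul, Set.mem_image, Set.mem_ofPred_eq]
    constructor
    · rintro ⟨u, hu, rfl⟩
      have := hneg u (by omega)
      have := hlt u
      omega
    · intro h
      refine ⟨-t, ?_, neg_neg t⟩
      have := hneg t (by omega)
      omega

theorem IsCodePair.isExtendedDuadic {p N : ℕ} [Fact p.Prime] {ζ γ : ZMod p}
    (h : IsCodePair N ζ γ) (hN : Odd N) (hp : (p : ZMod N) = 1) :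
    IsExtendedDuadic p N (extendedCode γ (halfCyclicCode N ζ)) := by
  have : NeZero N := ⟨hN.pos.ne'⟩
  refine ⟨halfCyclicCode N ζ, γ, ⟨hN, ?_, algebraMap _ _ ζ, ?_, _, _,
    isSplitting_half p N hN hp, ?_⟩, h.one_add_sq_mul, rfl⟩
  · have : IsUnit (p : ZMod N) := by rw [hp]; exact isUnit_one
    exact ((ZMod.isUnit_iff_coprime p N).1 this).symm
  · refine IsPrimitiveRoot.map_of_injective (f := algebraMap (ZMod p) (AlgebraicClosure (ZMod p)))
      ?_ (RingHom.injective _)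
    refine (IsPrimitiveRoot.iff hN.pos).2 ⟨h.pow_eq_one, fun l h0 hl h1 => ?_⟩
    have := h.isUnit_pow_sub_one l h0 hl
    rw [h1, sub_self] at this
    exact not_isUnit_zero this
  · ext c
    change (∀ t, 0 < t → 2 * t < N → _) ↔ ∀ t : ZMod N, 0 < t.val ∧ 2 * t.val < N → _
    have key : ∀ t : ℕ, ∑ j : Fin N, algebraMap (ZMod p) (AlgebraicClosure (ZMod p)) (c j) *
        algebraMap (ZMod p) (AlgebraicClosure (ZMod p)) ζ ^ (t * j.val) = 0 ↔
        ∑ j : Fin N, c j * ζ ^ (t * j.val) = 0 := by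
      intro t
      rw [← map_eq_zero (algebraMap (ZMod p) (AlgebraicClosure (ZMod p)))]
      simp only [map_sum, map_mul, map_pow]
    simp only [key]
    constructor
    · intro h t ht
      exact h t.val ht.1 ht.2
    · intro h t h0 ht
      have hv := ZMod.val_natCast_of_lt (show t < N by omega)
      simpa only [hv] using h (t : ZMod N) (by rw [hv]; exact ⟨h0, ht⟩)

/-! ### Existence of pairs modulo primes and prime powers. -/

/-- As `p ≡ 1` mod `N`, the Jacobi symbol `(p/N)` is `1`. Reciprocity then gives `(N/p) = (-1/p)`,
both `-1` in the first case and `1` in the second. -/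
theorem isSquare_neg_natCast {p N : ℕ} [Fact p.Prime] (hN : N ∣ p - 1)
    (hcase : (N % 4 = 3 ∧ p % 4 = 3) ∨ (N % 4 = 1 ∧ p % 4 = 1)) :
    IsSquare (((-N : ℤ)) : ZMod p) := by
  have hp := (Fact.out : p.Prime)
  have hNp : N < p := by
    have := Nat.le_of_dvd (by have := hp.two_le; omega) hN
    have := hp.pos
    omega
  have hN0 : N ≠ 0 := by rintro rfl; omega
  have h0 : ((-N : ℤ) : ZMod p) ≠ 0 := by
    push_cast
    rw [neg_ne_zero, Ne, ZMod.natCast_eq_zero_iff]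
    exact Nat.not_dvd_of_pos_of_lt (Nat.pos_of_ne_zero hN0) hNp
  have hpN : jacobiSym (p : ℤ) N = 1 := by
    rw [jacobiSym.mod_left' (a₂ := 1), jacobiSym.one_left]
    have : (N : ℤ) ∣ (p : ℤ) - 1 := by
      have := Int.natCast_dvd_natCast.2 hN
      rwa [Nat.cast_sub hp.one_le, Nat.cast_one] at this
    exact Int.emod_eq_emod_iff_emod_sub_eq_zero.2 (Int.emod_eq_zero_of_dvd this)
  have hodd : Odd p := Nat.odd_iff.2 (by omega)
  rw [← legendreSym.eq_one_iff p h0, jacobiSym.legendreSym.to_jacobiSym, ← neg_one_mul, jacobiSym.mul_left,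
    jacobiSym.at_neg_one hodd]
  rcases hcase with ⟨h1, h2⟩ | ⟨h1, h2⟩
  · rw [jacobiSym.quadratic_reciprocity_three_mod_four h1 h2, hpN,
      ZMod.χ₄_nat_three_mod_four h2]
    norm_num
  · rw [jacobiSym.quadratic_reciprocity_one_mod_four h1 hodd, hpN,
      ZMod.χ₄_nat_one_mod_four h2]
    norm_num

theorem exists_isCodePair_prime {p N : ℕ} [Fact p.Prime] (hN : N ∣ p - 1)
    (hcase : (N % 4 = 3 ∧ p % 4 = 3) ∨ (N % 4 = 1 ∧ p % 4 = 1)) :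
    ∃ ζ γ : ZMod p, IsCodePair N ζ γ := by
  have hp := (Fact.out : p.Prime)
  obtain ⟨g, hg⟩ := IsCyclic.exists_ofOrder_eq_natCard (α := (ZMod p)ˣ)
  rw [Nat.card_eq_fintype_card, ZMod.card_units] at hg
  obtain ⟨d, hd⟩ := hN
  have hprim : IsPrimitiveRoot ((g : ZMod p) ^ d) N := by
    have h1 := (IsPrimitiveRoot.orderOf g).pow (b := N) (a := d)
      (by rw [hg]; have := hp.two_le; omega) (by rw [hg, hd, mul_comm])
    simpa using (IsPrimitiveRoot.coe_units_iff.2 h1)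
  obtain ⟨y, hy⟩ := isSquare_neg_natCast (p := p) ⟨d, hd⟩ hcase
  have hN0 : (N : ZMod p) ≠ 0 := by
    rw [Ne, ZMod.natCast_eq_zero_iff]
    intro hpN
    have h1 := (hpN.mul_right d)
    rw [← hd] at h1
    have := Nat.le_of_dvd (by have := hp.two_le; omega) h1
    have := hp.two_le
    omega
  refine ⟨_, y * (N : ZMod p)⁻¹, hprim.pow_eq_one, ?_, ?_⟩
  · intro m h0 hm
    exact (sub_ne_zero.2 (hprim.pow_ne_one_of_pos_of_lt h0.ne' hm)).isUnit
  · push_cast at hy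
    field_simp
    linear_combination -hy

theorem exists_isCodePair_prime_pow {p e N : ℕ} [Fact p.Prime] (hN : N ∣ p - 1)
    (hcase : (N % 4 = 3 ∧ p % 4 = 3) ∨ (N % 4 = 1 ∧ p % 4 = 1)) (he : 0 < e) :
    ∃ ζ γ : ZMod (p ^ e), IsCodePair N ζ γ := by
  have hp := (Fact.out : p.Prime)
  obtain ⟨ζ₀, γ₀, h⟩ := exists_isCodePair_prime hN hcase
  obtain ⟨z, rfl⟩ := ZMod.intCast_surjective ζ₀
  obtain ⟨g, rfl⟩ := ZMod.intCast_surjective γ₀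
  obtain ⟨e, rfl⟩ : ∃ e', e = e' + 1 := ⟨e - 1, by omega⟩
  -- Each `p`-th power gains a factor `p` in a congruence to `1`.
  have hlift : ∀ a : ℤ, ((a : ZMod p) = 1) → ((a : ZMod (p ^ (e + 1))) ^ p ^ e = 1) := by
    intro a ha
    have h1 : (p : ℤ) ∣ a - 1 := by
      rw [← ZMod.intCast_zmod_eq_zero_iff_dvd _ p] 
      push_cast
      rw [ha, sub_self]
    have h2 := dvd_sub_pow_of_dvd_sub h1 e
    rw [one_pow, ← Nat.cast_pow, ← ZMod.intCast_zmod_eq_zero_iff_dvd] at h2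
    push_cast at h2
    exact sub_eq_zero.1 h2
  obtain ⟨r, hr⟩ : Odd (p ^ e) := (Nat.odd_iff.2 (by omega)).pow
  -- With `p ^ e = 2 r + 1`, this choice of `γ` gives `-γ² N = (-g² N) ^ (p ^ e) = 1`.
  refine ⟨(z : ZMod (p ^ (e + 1))) ^ p ^ e,
    g * (-(g : ZMod (p ^ (e + 1))) ^ 2 * N) ^ r, ?_, ?_, ?_⟩
  · rw [← pow_mul, mul_comm, pow_mul]
    have := hlift (z ^ N) (by push_cast; exact h.pow_eq_one)
    push_cast at this
    exact this
  · intro m h0 hm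
    have h1 := (h.isUnit_pow_sub_one m h0 hm).ne_zero
    -- Frobenius is the identity on `ℤ/p`, so the lifted root still reduces to `z`.
    have h2 : ((((z ^ p ^ e) ^ m - 1 : ℤ)) : ZMod p) ≠ 0 := by
      push_cast
      rwa [ZMod.pow_card_pow]
    rw [Ne, ZMod.intCast_zmod_eq_zero_iff_dvd] at h2
    have h3 : IsUnit ((((z ^ p ^ e) ^ m - 1 : ℤ)) : ZMod (p ^ (e + 1))) := by
      rw [ZMod.coe_int_isUnit_iff_isCoprime, Nat.cast_pow]
      exact ((Nat.prime_iff_prime_int.1 hp).coprime_iff_not_dvd.2 h2).pow_left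
    push_cast at h3
    exact h3
  · have := hlift (-g ^ 2 * N) (by push_cast; linear_combination -h.one_add_sq_mul)
    push_cast at this
    rw [hr] at this
    linear_combination -this

end RingCodes

/-- The length of the codes is `n = N + 1`, the length of the underlying duadic codes is
`N = n - 1`, and the modulus is `m = ∏ pᵢ ^ eᵢ`. -/
theorem mainTheorem7 (N s : ℕ) (hs : 0 < s) (p e : Fin s → ℕ) [∀ i, Fact (p i).Prime]
    (hp : Function.Injective p) (he : ∀ i, 0 < e i)
    (hN : ∀ i, N ∣ p i - 1)
    (hcase : (N + 1 ≡ 0 [MOD 4] ∧ ∀ i, p i ≡ 3 [MOD 4]) ∨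
      (N + 1 ≡ 2 [MOD 4] ∧ ∀ i, p i ≡ 1 [MOD 4])) :
    ∃ (E : ∀ i, Submodule (ZMod (p i)) (Fin (N + 1) → ZMod (p i)))
      (C : ∀ i, Submodule (ZMod (p i ^ e i)) (Fin (N + 1) → ZMod (p i ^ e i))),
      (∀ i, RingCodes.IsExtendedDuadic (p i) N (E i) ∧
        RingCodes.IsMDS (E i) ∧ RingCodes.IsSelfDual (E i)) ∧
      (∀ i, RingCodes.IsLift (he i) (C i) (E i) ∧
        RingCodes.IsMDS (C i) ∧ RingCodes.IsSelfDual (C i)) ∧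
      RingCodes.IsMDS (RingCodes.chineseProduct (fun i => p i ^ e i) C) ∧
      RingCodes.IsSelfDual (RingCodes.chineseProduct (fun i => p i ^ e i) C) := by
  have hcase' : ∀ i, (N % 4 = 3 ∧ p i % 4 = 3) ∨ (N % 4 = 1 ∧ p i % 4 = 1) := by
    intro i
    simp only [Nat.ModEq] at hcase
    rcases hcase with ⟨h1, h2⟩ | ⟨h1, h2⟩ <;> have := h2 i <;> omega
  have hodd : Odd N := by
    have := hcase' ⟨0, hs⟩
    exact Nat.odd_iff.2 (by omega)
  have hpN : ∀ i, (p i : ZMod N) = 1 := by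
    intro i
    have hi := (Fact.out : (p i).Prime).one_le
    rw [← sub_eq_zero, ← Nat.cast_one, ← Nat.cast_sub hi, ZMod.natCast_eq_zero_iff]
    exact hN i
  choose ζ γ h using fun i => RingCodes.exists_isCodePair_prime_pow (hN i) (hcase' i) (he i)
  have hq : Pairwise (Function.onFun Nat.Coprime fun i => p i ^ e i) := fun i j hij =>
    Nat.Coprime.pow _ _ ((Nat.coprime_primes Fact.out Fact.out).2 (hp.ne hij))
  have hq1 : ∀ i, 1 < p i ^ e i := fun i => Nat.one_lt_pow (he i).ne' (Fact.out : (p i).Prime).one_lt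
  have hm : 1 < ∏ i, p i ^ e i :=
    (hq1 ⟨0, hs⟩).trans_le (Nat.le_of_dvd (Finset.prod_pos fun i _ => (hq1 i).le)
      (Finset.dvd_prod_of_mem _ (Finset.mem_univ _)))
  have := Fact.mk hm
  have : NeZero (∏ i, p i ^ e i) := ⟨by omega⟩
  have := fun i => Fact.mk (hq1 i)
  have : ∀ i, NeZero (p i ^ e i) := fun i => ⟨by have := hq1 i; omega⟩
  let φ := ZMod.prodEquivPi (fun i => p i ^ e i) hq
  -- The pairs over the factors glue to a single pair over `ℤ/m`.
  have hprod := (RingCodes.isCodePair_pi h).map φ.symm.toRingHom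
  let f := fun i => ZMod.castHom (dvd_pow_self (p i) (he i).ne') (ZMod (p i))
  have hchin : RingCodes.chineseProduct (fun i => p i ^ e i)
      (fun i => RingCodes.extendedCode (γ i) (RingCodes.halfCyclicCode N (ζ i))) =
      RingCodes.extendedCode (φ.symm γ) (RingCodes.halfCyclicCode N (φ.symm ζ)) := by
    simpa [φ, -ZMod.prodEquivPi_apply] using
      RingCodes.chineseProduct_extendedCode (N := N) _ hq (φ.symm ζ) (φ.symm γ)
  refine ⟨fun i => RingCodes.extendedCode (f i (γ i)) (RingCodes.halfCyclicCode N (f i (ζ i))),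
    fun i => RingCodes.extendedCode (γ i) (RingCodes.halfCyclicCode N (ζ i)), fun i =>
      ⟨((h i).map (f i)).isExtendedDuadic hodd (hpN i), ((h i).map (f i)).isMDS hodd,
        ((h i).map (f i)).isSelfDual hodd⟩, fun i =>
      ⟨RingCodes.isLift_extendedCode (he i) (h i) hodd (f i), (h i).isMDS hodd,
        (h i).isSelfDual hodd⟩, ?_, ?_⟩
  · rw [hchin]
    exact hprod.isMDS hodd
  · rw [hchin]
    exact hprod.isSelfDual hodd
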